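/- Let $\mathbb N=\{1,2,3,\dots\}$. For nonempty finite sets $H,K\subseteq\mathbb N$ write $H<K$ if $\max H<\min K$. A set $A\subseteq\mathbb N$ is an $IP$-set if there is a sequence $(x_t)_{t\ge 1}$ in $\mathbb N$ such that $\sum_{t\in H}x_t\in A$ for every nonempty finite $H\subseteq\mathbb N$; it is an $IP^\star$-set if it meets every $IP$-set. For $n\in\mathbb N$, a set $A\subseteq\mathbb N$ is an $IP^n$-set if there are sequences $(x_{i,t})_{t\ge1}$ in $\mathbb N$, $1\le i\le n$, such that $\sum_{i=1}^n\sum_{t\in H_i}x_{i,t}\in A$ for all nonempty finite sets $H_1<H_2<\dots<H_n$ in $\mathbb N$; it is an $IP^{n\star}$-set if it meets every $IP^n$-set in $\mathbb N$. Let $(X,\mathcal B,\mu,T)$ be a measure preserving system: $(X,\mathcal B,\mu)$ is a probability space and $T:X\to X$ is a (not necessarily invertible) measurable map with $\mu(T^{-1}B)=\mu(B)$ for all $B\in\mathcal B$. It is called mild mixing if for all $\varepsilon>0$ and all $A,B\in\mathcal B$ with $\mu(A)\mu(B)>0$ the set $\{m\in\mathbb N:|\mu(A\cap T^{-m}B)-\mu(A)\mu(B)|<\varepsilon\}$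 is an $IP^\star$-set. **Corollary.** Let $k,n\in\mathbb N$, let $(X,\mathcal B,\mu,T)$ be a mild mixing system, and let $A_0,A_1,\dots,A_k\in\mathcal B$ with $\mu(A_0)\mu(A_1)\cdots\mu(A_k)>0$. Then $$\Big\{m\in\mathbb N:\mu\Big(\bigcap_{i=0}^k T^{-im}A_i\Big)>0\Big\}$$ is an $IP^{n\star}$-set. -/

import Mathlib

open MeasureTheory

/-- A set `A` of positive integers is an IP-set if it contains all finite sums (over nonempty
finite index sets) of some infinite sequence of positive integers. -/
def IsIPSet (A : Set ℕ) : Prop :=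
  ∃ x : ℕ → ℕ, (∀ t, 0 < x t) ∧
    ∀ H : Finset ℕ, H.Nonempty → ∑ t ∈ H, x t ∈ A

/-- A set is an IP⋆-set if it meets every IP-set of positive integers. -/
def IsIPStarSet (A : Set ℕ) : Prop :=
  ∀ B : Set ℕ, (∀ b ∈ B, 0 < b) → IsIPSet B → (A ∩ B).Nonempty

/-- A set `A` is an IPⁿ-set if there are `n` sequences `x 1, …, x n` of positive integers such that
`A` contains all sums `∑ i, ∑ t ∈ H i, x i t` with nonempty finite sets `H 1 < H 2 < ⋯ < H n`,
where `H < K` means that every element of `H` is smaller than every element of `K`. -/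
def IsIPnSet (n : ℕ) (A : Set ℕ) : Prop :=
  ∃ x : Fin n → ℕ → ℕ, (∀ i t, 0 < x i t) ∧
    ∀ H : Fin n → Finset ℕ, (∀ i, (H i).Nonempty) →
      (∀ i j, i < j → ∀ s ∈ H i, ∀ t ∈ H j, s < t) →
      ∑ i, ∑ t ∈ H i, x i t ∈ A

/-- A set is an IPⁿ⋆-set if it meets every IPⁿ-set of positive integers. -/
def IsIPnStarSet (n : ℕ) (A : Set ℕ) : Prop :=
  ∀ B : Set ℕ, (∀ b ∈ B, 0 < b) → IsIPnSet n B → (A ∩ B).Nonempty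

/-- The map `T` makes the probability space `(X, μ)` a mild mixing measure preserving system. -/
structure IsMildMixing {X : Type*} [MeasurableSpace X] (μ : Measure X) (T : X → X) : Prop where
  isProbabilityMeasure : IsProbabilityMeasure μ
  measurePreserving : MeasurePreserving T μ μ
  isIPStarSet : ∀ ε : ℝ, 0 < ε → ∀ A B : Set X, MeasurableSet A → MeasurableSet B →
    0 < μ A * μ B →
    IsIPStarSet {n : ℕ | 0 < n ∧ |μ.real (A ∩ T^[n] ⁻¹' B) - μ.real A * μ.real B| < ε}

/-!
A set is an IP⋆-set if and only if it belongs to every idempotent ultrafilter on the positive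
integers, so mild mixing says that `μ (A ∩ T⁻ⁿ B)` tends to `μ A * μ B` along every such
ultrafilter `U`. The set `⋂ i, T⁻ⁱⁿ A i` is the intersection of `A 0` with the `T⁻ⁿ`-preimage of
a set of the same kind with one fewer factor, so multiple mixing along `U` follows by induction
from a van der Corput lemma: the correlation at lag `h` of the latter sets has a limit governed by
the sets `T⁻⁽ⁱ⁺¹⁾ʰ A (i+1) ∩ A (i+1)`, and the multiples of `U` are again idempotent. Finally, an
IPⁿ-set contains a translate of an IP-set by some `c`, and translating the time by `c` amounts to
replacing each `A i` by `T⁻ⁱᶜ A i`, which has the same measure.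
-/

open Filter Topology

attribute [local instance] Ultrafilter.add Ultrafilter.addSemigroup

theorem eventually_eventually_add {M : Type*} [Add M] {U : Ultrafilter M} (hU : U + U = U)
    {P : M → Prop} (hP : ∀ᶠ n in U, P n) : ∀ᶠ m in U, ∀ᶠ n in U, P (m + n) := by
  rwa [← Ultrafilter.eventually_add, hU]

theorem ultrafilter_map_add {M N : Type*} [Add M] [Add N] (φ : M →ₙ+ N) (U V : Ultrafilter M) :
    (U + V).map φ = U.map φ + V.map φ := by
  refine Ultrafilter.coe_inj.mp (Filter.ext' fun P => ?_)
  simp [Ultrafilter.eventually_add]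

theorem exists_pairwise_of_eventually_add {M : Type*} [AddSemigroup M] {U : Ultrafilter M}
    (hU : U + U = U) {P : M → Prop} {r : M → M → Prop} (hP : ∀ᶠ n in U, P n)
    (hr : ∀ᶠ h in U, ∀ᶠ n in U, r n (h + n)) (N : ℕ) :
    ∃ a : Fin N → M, (∀ i, P (a i)) ∧ ∀ i j, i < j → r (a i) (a j) := by
  -- The sequence is built backwards: `n` stays variable, and choosing a value `m` for it replaces
  -- `n, a i + n` by `n, m + n, a i + m + n`.
  let Extendable (m : M) : Prop := P m ∧ ∀ᶠ n in U, r n (m + n)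
  let Good {N : ℕ} (a : Fin N → M) : Prop := (∀ i, Extendable (a i)) ∧ ∀ i j, i < j → r (a i) (a j)
  have good_cons {N : ℕ} {n : M} {a : Fin N → M} (hn : Extendable n) (hna : ∀ i, r n (a i))
      (ha : Good a) : Good (Fin.cons n a : Fin (N + 1) → M) :=
    ⟨Fin.cases hn ha.1, Fin.cases (Fin.cases (by simp) fun j _ => hna j)
      fun i => Fin.cases (by simp) fun j hij => ha.2 i j (Fin.succ_lt_succ_iff.mp hij)⟩
  have hext : ∀ᶠ n in U, Extendable n := hP.and hr
  suffices ∃ a : Fin N → M, ∀ᶠ n in U, Good (Fin.cons n (a · + n) : Fin (N + 1) → M) by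
    obtain ⟨a, ha⟩ := this
    obtain ⟨n, hn⟩ := ha.exists
    exact ⟨(a · + n), fun i => (hn.1 i.succ).1,
      fun i j hij => hn.2 i.succ j.succ (Fin.succ_lt_succ_iff.mpr hij)⟩
  induction N with
  | zero =>
    exact ⟨Fin.elim0, hext.mono fun n hn => good_cons hn (·.elim0) ⟨(·.elim0), (·.elim0)⟩⟩
  | succ N ih =>
    obtain ⟨a, ha⟩ := ih
    obtain ⟨m, hm, hmn⟩ := (ha.and (eventually_eventually_add hU ha)).exists
    refine ⟨Fin.cons m (a · + m), ?_⟩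
    filter_upwards [hext, eventually_all.mpr fun i => (hm.1 i).2, hmn] with n hn hrn hgood
    refine good_cons hn hrn ?_
    convert hgood using 1
    ext i
    cases i using Fin.cases <;> simp [add_assoc]

section VanDerCorput

open scoped InnerProductSpace

variable {E : Type*} [NormedAddCommGroup E] [InnerProductSpace ℝ E]

theorem norm_sum_sq_le_of_pairwise_inner_le {ι : Type*} [Fintype ι] {u : ι → E} {C η : ℝ}
    (hη : 0 ≤ η) (hC : ∀ i, ‖u i‖ ≤ C) (hu : Pairwise fun i j => ⟪u i, u j⟫_ℝ ≤ η) :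
    ‖∑ i, u i‖ ^ 2 ≤ Fintype.card ι * (C ^ 2 + Fintype.card ι * η) := by
  classical
  have inner_le (i j : ι) : ⟪u i, u j⟫_ℝ ≤ (if i = j then C ^ 2 else 0) + η := by
    split_ifs with hij
    · subst hij
      rw [real_inner_self_eq_norm_sq]
      have := pow_le_pow_left₀ (norm_nonneg _) (hC i) 2
      linarith
    · simpa using hu hij
  calc ‖∑ i, u i‖ ^ 2 = ∑ i, ∑ j, ⟪u i, u j⟫_ℝ := by
        simp_rw [← real_inner_self_eq_norm_sq, sum_inner, inner_sum]
    _ ≤ ∑ i, ∑ j, ((if i = j then C ^ 2 else 0) + η) := by gcongr; exact inner_le _ _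
    _ = Fintype.card ι * (C ^ 2 + Fintype.card ι * η) := by
        simp only [Finset.sum_add_distrib, Finset.sum_ite_eq, Finset.mem_univ, if_true,
          Finset.sum_const, Finset.card_univ, nsmul_eq_mul]
        ring

theorem card_mul_sq_le_of_pairwise_inner_le {ι : Type*} [Fintype ι] {u : ι → E} {w : E}
    {C δ η : ℝ} (hη : 0 ≤ η) (hδ : 0 ≤ δ) (hC : ∀ i, ‖u i‖ ≤ C)
    (hu : Pairwise fun i j => ⟪u i, u j⟫_ℝ ≤ η) (hw : ∀ i, δ ≤ ⟪u i, w⟫_ℝ) :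
    Fintype.card ι * δ ^ 2 ≤ (C ^ 2 + Fintype.card ι * η) * ‖w‖ ^ 2 := by
  rcases isEmpty_or_nonempty ι with _ | _
  · simp only [Fintype.card_eq_zero, Nat.cast_zero, zero_mul, add_zero]
    positivity
  refine le_of_mul_le_mul_left ?_ (Nat.cast_pos.mpr (Fintype.card_pos (α := ι)) : (0 : ℝ) < _)
  calc (Fintype.card ι : ℝ) * (Fintype.card ι * δ ^ 2) = (∑ _i : ι, δ) ^ 2 := by
        rw [Finset.sum_const, Finset.card_univ, nsmul_eq_mul]
        ring
    _ ≤ (∑ i, ⟪u i, w⟫_ℝ) ^ 2 := by gcongr; exact hw _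
    _ = ⟪∑ i, u i, w⟫_ℝ ^ 2 := by rw [sum_inner]
    _ ≤ (‖∑ i, u i‖ * ‖w‖) ^ 2 := by
        rw [sq_le_sq, abs_of_nonneg (by positivity : 0 ≤ ‖∑ i, u i‖ * ‖w‖)]
        exact abs_real_inner_le_norm _ w
    _ = ‖∑ i, u i‖ ^ 2 * ‖w‖ ^ 2 := mul_pow ..
    _ ≤ (Fintype.card ι * (C ^ 2 + Fintype.card ι * η)) * ‖w‖ ^ 2 := by
        gcongr; exact norm_sum_sq_le_of_pairwise_inner_le hη hC hu
    _ = Fintype.card ι * ((C ^ 2 + Fintype.card ι * η) * ‖w‖ ^ 2) := mul_assoc ..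

variable {M : Type*} [AddSemigroup M] {U : Ultrafilter M} {u : M → E} {C : ℝ}

theorem eventually_inner_lt_of_eventually_inner_add_lt (hU : U + U = U)
    (hC : ∀ᶠ n in U, ‖u n‖ ≤ C)
    (hu : ∀ η > 0, ∀ᶠ h in U, ∀ᶠ n in U, ⟪u (h + n), u n⟫_ℝ < η) (w : E) {δ : ℝ} (hδ : 0 < δ) :
    ∀ᶠ n in U, ⟪u n, w⟫_ℝ < δ := by
  by_contra hcon
  have hlarge : ∀ᶠ n in U, δ ≤ ⟪u n, w⟫_ℝ := by
    simpa only [not_lt] using Ultrafilter.eventually_not.mpr hcon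
  obtain ⟨N, hN⟩ := exists_nat_gt ((C ^ 2 + 1) * ‖w‖ ^ 2 / δ ^ 2)
  have hN0 : (0 : ℝ) < N := lt_of_le_of_lt (by positivity) hN
  rw [div_lt_iff₀ (by positivity)] at hN
  obtain ⟨a, ha, hpair⟩ := exists_pairwise_of_eventually_add hU
    (r := fun m n => ⟪u n, u m⟫_ℝ < 1 / N) (hC.and hlarge) (hu (1 / N) (by positivity)) N
  have hle := card_mul_sq_le_of_pairwise_inner_le (u := fun i => u (a i)) (η := 1 / N)
    (by positivity) hδ.le (fun i => (ha i).1) ?_ (fun i => (ha i).2)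
  · rw [Fintype.card_fin, mul_one_div_cancel hN0.ne'] at hle
    exact hN.not_ge hle
  · intro i j hij
    rcases hij.lt_or_gt with hlt | hlt
    · exact real_inner_comm (u (a j)) (u (a i)) ▸ (hpair i j hlt).le
    · exact (hpair j i hlt).le

theorem tendsto_inner_zero_of_eventually_inner_add_lt (hU : U + U = U)
    (hC : ∀ᶠ n in U, ‖u n‖ ≤ C)
    (hu : ∀ η > 0, ∀ᶠ h in U, ∀ᶠ n in U, ⟪u (h + n), u n⟫_ℝ < η) (v : E) :
    Tendsto (fun n => ⟪u n, v⟫_ℝ) U (𝓝 0) := by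
  refine Metric.tendsto_nhds.mpr fun ε hε => ?_
  filter_upwards [eventually_inner_lt_of_eventually_inner_add_lt hU hC hu v hε,
    eventually_inner_lt_of_eventually_inner_add_lt hU hC hu (-v) hε] with n hv hnegv
  rw [inner_neg_right] at hnegv
  rw [Real.dist_0_eq_abs, abs_lt]
  exact ⟨by linarith, hv⟩

theorem tendsto_inner_of_eventually_inner_add_lt (hU : U + U = U) {w : E}
    (hC : ∀ᶠ n in U, ‖u n‖ ≤ C) (hw : Tendsto (fun n => ⟪u n, w⟫_ℝ) U (𝓝 (‖w‖ ^ 2)))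
    (hu : ∀ η > 0, ∀ᶠ h in U, ∀ᶠ n in U, ⟪u (h + n), u n⟫_ℝ < ‖w‖ ^ 2 + η) (v : E) :
    Tendsto (fun n => ⟪u n, v⟫_ℝ) U (𝓝 ⟪w, v⟫_ℝ) := by
  have hbound : ∀ᶠ n in U, ‖u n - w‖ ≤ C + ‖w‖ :=
    hC.mono fun n hn => (norm_sub_le _ _).trans (by gcongr)
  have hcorr (η : ℝ) (hη : 0 < η) :
      ∀ᶠ h in U, ∀ᶠ n in U, ⟪u (h + n) - w, u n - w⟫_ℝ < η := by
    have hnear : ∀ᶠ n in U, ‖w‖ ^ 2 - η / 3 < ⟪u n, w⟫_ℝ :=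
      hw.eventually_const_lt (by linarith)
    filter_upwards [hu (η / 3) (by positivity), eventually_eventually_add hU hnear]
      with h huh hwh
    filter_upwards [huh, hwh, hnear] with n hun hwhn hwn
    rw [inner_sub_left, inner_sub_right, inner_sub_right, real_inner_comm (u n) w,
      real_inner_self_eq_norm_sq]
    linarith
  have hsub := tendsto_inner_zero_of_eventually_inner_add_lt hU hbound hcorr v
  simpa [inner_sub_left] using hsub.add_const ⟪w, v⟫_ℝ

end VanDerCorput

theorem exists_sum_eq_of_mem_FS {M : Type*} [AddCommMonoid M] {a : Stream' M} {m : M}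
    (hm : m ∈ Hindman.FS a) : ∃ H : Finset ℕ, H.Nonempty ∧ ∑ t ∈ H, a.get t = m := by
  have sum_map_succ (a : Stream' M) (H : Finset ℕ) :
      ∑ t ∈ H.map (addRightEmbedding 1), a.get t = ∑ t ∈ H, a.tail.get t := by
    simp [Stream'.get_tail]
  induction hm with
  | head' a => exact ⟨{0}, by simp, by simp [Stream'.head]⟩
  | tail' a m _ ih =>
    obtain ⟨H, hH, rfl⟩ := ih
    exact ⟨H.map (addRightEmbedding 1), by simpa using hH, sum_map_succ a H⟩
  | cons' a m _ ih =>
    obtain ⟨H, -, rfl⟩ := ih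
    refine ⟨insert 0 (H.map (addRightEmbedding 1)), by simp, ?_⟩
    rw [Finset.sum_insert (by simp), sum_map_succ, Stream'.head]

theorem isIPSet_iff_exists_FS_subset {B : Set ℕ} (hB : ∀ b ∈ B, 0 < b) :
    IsIPSet B ↔ ∃ a : Stream' ℕ, Hindman.FS a ⊆ B := by
  constructor
  · rintro ⟨x, -, hx⟩
    refine ⟨x, fun m hm => ?_⟩
    obtain ⟨H, hH, rfl⟩ := exists_sum_eq_of_mem_FS hm
    exact hx H hH
  · rintro ⟨a, ha⟩
    exact ⟨a.get, fun t => hB _ (ha (Hindman.FS.singleton a t)),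
      fun H hH => ha (Hindman.FS.finsetSum a H hH)⟩

theorem isIPStarSet_iff_forall_mem_ultrafilter {A : Set ℕ} :
    IsIPStarSet A ↔ ∀ U : Ultrafilter ℕ, U + U = U → (∀ᶠ m in U, 0 < m) → A ∈ U := by
  constructor
  · intro hA U hU hpos
    by_contra hAU
    obtain ⟨a, ha⟩ := Hindman.exists_FS_of_large U hU (Aᶜ ∩ {m | 0 < m})
      (inter_mem (Ultrafilter.compl_mem_iff_notMem.mpr hAU) hpos)
    have hapos : ∀ m ∈ Hindman.FS a, 0 < m := fun m hm => (ha hm).2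
    obtain ⟨m, hmA, hm⟩ :=
      hA _ hapos ((isIPSet_iff_exists_FS_subset hapos).mpr ⟨a, subset_rfl⟩)
    exact (ha hm).1 hmA
  · intro hA B hB hBIP
    obtain ⟨a, ha⟩ := (isIPSet_iff_exists_FS_subset hB).mp hBIP
    obtain ⟨U, hU, haU⟩ := Hindman.exists_idempotent_ultrafilter_le_FS a
    have hBU : B ∈ U := mem_of_superset haU ha
    exact Ultrafilter.nonempty_of_mem (inter_mem (hA U hU (mem_of_superset hBU hB)) hBU)

theorem IsIPnSet.exists_isIPSet_add_mem {n : ℕ} {B : Set ℕ} (hB : IsIPnSet (n + 1) B) :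
    ∃ c, IsIPSet {m | 0 < m ∧ c + m ∈ B} := by
  obtain ⟨x, hx, hxB⟩ := hB
  -- Take `H i = {i}` for `i < n`, which contributes the constant `c`, and let only `H n` vary.
  refine ⟨∑ i : Fin n, x i.castSucc i, fun t => x (Fin.last n) (t + n), fun t => hx _ _,
    fun K hK => ⟨Finset.sum_pos (fun t _ => hx _ _) hK, ?_⟩⟩
  let H : Fin (n + 1) → Finset ℕ :=
    Fin.snoc (α := fun _ => Finset ℕ) (fun i => {(i : ℕ)}) (K.map (addRightEmbedding n))
  have hHne (i) : (H i).Nonempty := by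
    induction i using Fin.lastCases <;> simp [H, hK]
  have eq_of_mem {i : Fin n} {s : ℕ} (hs : s ∈ H i.castSucc) : s = i := by
    simpa [H] using hs
  have le_of_mem {i : Fin (n + 1)} {t : ℕ} (ht : t ∈ H i) : (i : ℕ) ≤ t := by
    induction i using Fin.lastCases with
    | last =>
      obtain ⟨t', -, rfl⟩ : ∃ t' ∈ K, t' + n = t := by simpa [H] using ht
      simp
    | cast i => exact (eq_of_mem ht).ge
  have hHlt (i j) (hij : i < j) : ∀ s ∈ H i, ∀ t ∈ H j, s < t := by
    intro s hs t ht
    induction i using Fin.lastCases with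
    | last => exact absurd hij (Fin.le_last j).not_gt
    | cast i => exact (eq_of_mem hs).trans_lt (lt_of_lt_of_le hij (le_of_mem ht))
  simpa [H, Fin.sum_univ_castSucc] using hxB H hHne hHlt

theorem isIPnStarSet_of_forall_isIPStarSet_add_mem {A : Set ℕ}
    (hA : ∀ c, IsIPStarSet {m | c + m ∈ A}) (n : ℕ) : IsIPnStarSet n A := by
  intro B hB hBIP
  cases n with
  | zero =>
    obtain ⟨x, -, hx⟩ := hBIP
    exact absurd (hB _ (hx Fin.elim0 (·.elim0) (·.elim0))) (by simp)
  | succ n =>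
    obtain ⟨c, hc⟩ := hBIP.exists_isIPSet_add_mem
    obtain ⟨m, hmA, -, hmB⟩ := hA c _ (fun m hm => hm.1) hc
    exact ⟨c + m, hmA, hmB⟩

theorem IsIPnStarSet.mono {n : ℕ} {A A' : Set ℕ} (hA : IsIPnStarSet n A) (h : A ⊆ A') :
    IsIPnStarSet n A' :=
  fun B hB hBIP => (hA B hB hBIP).mono (Set.inter_subset_inter_left B h)

section MultipleMixing

variable {X : Type*} {T : X → X} {k : ℕ}

/-- The set `⋂ i, T^{-in} A i` of points whose orbit at times `0, n, 2n, …, (k - 1)n` visits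
`A 0, …, A (k - 1)` in this order. -/
def returnSet (T : X → X) (A : Fin k → Set X) (n : ℕ) : Set X :=
  ⋂ i : Fin k, T^[(i : ℕ) * n] ⁻¹' A i

theorem returnSet_succ (A : Fin (k + 1) → Set X) (n : ℕ) :
    returnSet T A n = A 0 ∩ T^[n] ⁻¹' returnSet T (fun i => A i.succ) n := by
  ext x
  simp [returnSet, Fin.forall_fin_succ, ← Function.iterate_add_apply, add_mul]

theorem returnSet_inter (A B : Fin k → Set X) (n : ℕ) :
    returnSet T (fun i => A i ∩ B i) n = returnSet T A n ∩ returnSet T B n := by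
  simp only [returnSet, Set.preimage_inter, Set.iInter_inter_distrib]

theorem returnSet_preimage_iterate (A : Fin k → Set X) (a c n : ℕ) :
    returnSet T (fun i => T^[a + i * c] ⁻¹' A i) n = T^[a] ⁻¹' returnSet T A (c + n) := by
  simp only [returnSet, Set.preimage_iInter, ← Set.preimage_comp, ← Function.iterate_add]
  exact Set.iInter_congr fun i => by ring_nf

theorem preimage_returnSet_add_inter (A : Fin k → Set X) (h n : ℕ) :
    T^[h + n] ⁻¹' returnSet T A (h + n) ∩ T^[n] ⁻¹' returnSet T A n =
      T^[n] ⁻¹' returnSet T (fun i => T^[h + i * h] ⁻¹' A i ∩ A i) n := by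
  rw [returnSet_inter, returnSet_preimage_iterate, Set.preimage_inter, ← Set.preimage_comp,
    ← Function.iterate_add]

variable [MeasurableSpace X] {μ : Measure X} {U : Ultrafilter ℕ}

theorem measurableSet_returnSet (hT : Measurable T) {A : Fin k → Set X}
    (hA : ∀ i, MeasurableSet (A i)) (n : ℕ) : MeasurableSet (returnSet T A n) :=
  .iInter fun i => hT.iterate _ (hA i)

theorem tendsto_measureReal_inter_of_eventually_inter_lt [IsProbabilityMeasure μ]
    {M : Type*} [AddSemigroup M] {V : Ultrafilter M} (hV : V + V = V) {E : M → Set X}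
    (hE : ∀ n, MeasurableSet (E n)) {c : ℝ}
    (hc : Tendsto (fun n => μ.real (E n)) V (𝓝 c))
    (hcorr : ∀ η > 0, ∀ᶠ h in V, ∀ᶠ n in V, μ.real (E (h + n) ∩ E n) < c ^ 2 + η)
    {B : Set X} (hB : MeasurableSet B) :
    Tendsto (fun n => μ.real (B ∩ E n)) V (𝓝 (μ.real B * c)) := by
  let ind {s : Set X} (hs : MeasurableSet s) : Lp ℝ 2 μ :=
    indicatorConstLp 2 hs (measure_ne_top μ s) 1
  have inner_ind {s t : Set X} (hs : MeasurableSet s) (ht : MeasurableSet t) :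
      inner ℝ (ind hs) (ind ht) = μ.real (s ∩ t) :=
    L2.real_inner_indicatorConstLp_one_indicatorConstLp_one hs ht
  set w : Lp ℝ 2 μ := c • ind .univ
  have inner_w {s : Set X} (hs : MeasurableSet s) : inner ℝ (ind hs) w = c * μ.real s := by
    rw [real_inner_smul_right, inner_ind, Set.inter_univ]
  have norm_w : ‖w‖ ^ 2 = c ^ 2 := by
    rw [← real_inner_self_eq_norm_sq, real_inner_smul_left, inner_w, probReal_univ]
    ring
  have norm_ind_le {s : Set X} (hs : MeasurableSet s) : ‖ind hs‖ ≤ 1 := by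
    refine norm_indicatorConstLp_le.trans ?_
    rw [norm_one, one_mul]
    exact Real.rpow_le_one measureReal_nonneg measureReal_le_one (by simp)
  have hlim := tendsto_inner_of_eventually_inner_add_lt hV (u := fun n => ind (hE n)) (w := w)
    (.of_forall fun n => norm_ind_le (hE n)) ?_ ?_ (ind hB)
  · rw [real_inner_comm, inner_w, mul_comm] at hlim
    simpa only [inner_ind, Set.inter_comm] using hlim
  · simpa only [inner_w, norm_w, sq] using hc.const_mul c
  · simpa only [inner_ind, norm_w] using hcorr

/-- Mixing along a filter `l` on the set of times: correlations of measurable sets tend to the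
product of the measures along `l`. Strong mixing is the case `l = atTop`; a mild mixing system is
mixing along every idempotent ultrafilter of positive times. -/
def IsMixingAlong (μ : Measure X) (T : X → X) (l : Filter ℕ) : Prop :=
  ∀ ⦃A B : Set X⦄, MeasurableSet A → MeasurableSet B →
    Tendsto (fun n => μ.real (A ∩ T^[n] ⁻¹' B)) l (𝓝 (μ.real A * μ.real B))

theorem tendsto_measureReal_returnSet_of_isMixingAlong [IsProbabilityMeasure μ]
    (hT : MeasurePreserving T μ μ) (hU : U + U = U)
    (hmix : ∀ i, 0 < i → IsMixingAlong μ T (map (i * ·) U))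
    {A : Fin k → Set X} (hA : ∀ i, MeasurableSet (A i)) :
    Tendsto (fun n => μ.real (returnSet T A n)) U (𝓝 (∏ i, μ.real (A i))) := by
  induction k with
  | zero => simp [returnSet]
  | succ k ih =>
    have hTm (n : ℕ) : Measurable T^[n] := hT.measurable.iterate n
    let A' : Fin k → Set X := fun i => A i.succ
    have hA' (i) : MeasurableSet (A' i) := hA i.succ
    have measureReal_preimage {B : Fin k → Set X} (hB : ∀ i, MeasurableSet (B i)) (n : ℕ) :
        μ.real (T^[n] ⁻¹' returnSet T B n) = μ.real (returnSet T B n) :=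
      (hT.iterate n).measureReal_preimage
        (measurableSet_returnSet hT.measurable hB n).nullMeasurableSet
    simp only [returnSet_succ, Fin.prod_univ_succ]
    refine tendsto_measureReal_inter_of_eventually_inter_lt hU
      (fun n => hTm n (measurableSet_returnSet hT.measurable hA' n)) ?_ (fun η hη => ?_) (hA 0)
    · simpa only [measureReal_preimage hA'] using ih hA'
    · have hpair (i : Fin k) : Tendsto (fun h => μ.real (T^[h + i * h] ⁻¹' A' i ∩ A' i)) U
          (𝓝 (μ.real (A' i) ^ 2)) := by
        have := tendsto_map'_iff.mp (hmix (1 + i) (by positivity) (hA' i) (hA' i))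
        simpa only [Function.comp_def, add_mul, one_mul, Set.inter_comm, sq] using this
      have hprod := tendsto_finsetProd Finset.univ fun i _ => hpair i
      rw [Finset.prod_pow] at hprod
      filter_upwards [hprod.eventually_lt_const (lt_add_of_pos_right _ hη)] with h hh
      have hB (i : Fin k) : MeasurableSet (T^[h + i * h] ⁻¹' A' i ∩ A' i) :=
        (hTm _ (hA' i)).inter (hA' i)
      simpa only [preimage_returnSet_add_inter, measureReal_preimage hB]
        using (ih hB).eventually_lt_const hh

theorem IsMildMixing.isMixingAlong (hT : IsMildMixing μ T) (hU : U + U = U)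
    (hpos : ∀ᶠ m in U, 0 < m) : IsMixingAlong μ T U := by
  intro A B hA hB
  have := hT.isProbabilityMeasure
  rcases eq_zero_or_pos (μ A * μ B) with h0 | h0
  · have inter_eq_zero (n : ℕ) : μ.real (A ∩ T^[n] ⁻¹' B) = 0 := by
      rw [measureReal_eq_zero_iff]
      rcases mul_eq_zero.mp h0 with hA0 | hB0
      · exact measure_mono_null Set.inter_subset_left hA0
      · refine measure_mono_null Set.inter_subset_right ?_
        rwa [(hT.measurePreserving.iterate n).measure_preimage hB.nullMeasurableSet]
    simp [inter_eq_zero, measureReal_def, ← ENNReal.toReal_mul, h0]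
  · refine Metric.tendsto_nhds.mpr fun ε hε => ?_
    filter_upwards [isIPStarSet_iff_forall_mem_ultrafilter.mp
      (hT.isIPStarSet ε hε A B hA hB h0) U hU hpos] with n hn using hn.2

theorem IsMildMixing.tendsto_measureReal_returnSet (hT : IsMildMixing μ T) (hU : U + U = U)
    (hpos : ∀ᶠ m in U, 0 < m) {A : Fin k → Set X} (hA : ∀ i, MeasurableSet (A i)) :
    Tendsto (fun n => μ.real (returnSet T A n)) U (𝓝 (∏ i, μ.real (A i))) := by
  have := hT.isProbabilityMeasure
  refine tendsto_measureReal_returnSet_of_isMixingAlong hT.measurePreserving hU (fun i hi => ?_) hA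
  refine hT.isMixingAlong (U := U.map (AddHom.mulLeft i)) ?_ ?_
  · rw [← ultrafilter_map_add, hU]
  · exact eventually_map.mpr (hpos.mono fun m hm => Nat.mul_pos hi hm)

theorem IsMildMixing.isIPnStarSet_abs_measureReal_returnSet_sub_lt (hT : IsMildMixing μ T)
    {A : Fin k → Set X} (hA : ∀ i, MeasurableSet (A i)) {ε : ℝ} (hε : 0 < ε) (n : ℕ) :
    IsIPnStarSet n {m | 0 < m ∧ |μ.real (returnSet T A m) - ∏ i, μ.real (A i)| < ε} := by
  refine isIPnStarSet_of_forall_isIPStarSet_add_mem (fun c => ?_) n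
  refine isIPStarSet_iff_forall_mem_ultrafilter.mpr fun U hU hpos => ?_
  have hTm (m : ℕ) := hT.measurePreserving.iterate m
  have hlim := hT.tendsto_measureReal_returnSet hU hpos fun i =>
    (hTm (0 + i * c)).measurable (hA i)
  simp only [returnSet_preimage_iterate, (hTm _).measureReal_preimage (hA _).nullMeasurableSet,
    Function.iterate_zero, Set.preimage_id] at hlim
  filter_upwards [hpos, Metric.tendsto_nhds.mp hlim ε hε] with m hm0 hm
  exact ⟨by omega, hm⟩

end MultipleMixing

theorem mainTheorem5 {X : Type*} [MeasurableSpace X] (μ : Measure X) (T : X → X)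
    (hT : IsMildMixing μ T) (k n : ℕ) (hk : 1 ≤ k) (hn : 1 ≤ n)
    (A : Fin (k + 1) → Set X) (hA : ∀ i, MeasurableSet (A i)) (hpos : 0 < ∏ i, μ (A i)) :
    IsIPnStarSet n
      {m : ℕ | 0 < m ∧ 0 < μ (⋂ i : Fin (k + 1), T^[(i : ℕ) * m] ⁻¹' (A i))} := by
  have := hT.isProbabilityMeasure
  have hprod : 0 < ∏ i, μ.real (A i) := Finset.prod_pos fun i _ =>
    ENNReal.toReal_pos (Finset.prod_ne_zero_iff.mp hpos.ne' i (Finset.mem_univ i))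
      (measure_ne_top μ _)
  refine (hT.isIPnStarSet_abs_measureReal_returnSet_sub_lt hA hprod n).mono ?_
  rintro m ⟨hm, hlt⟩
  have hreal : 0 < μ.real (returnSet T A m) := by linarith [(abs_lt.mp hlt).1]
  exact ⟨hm, (ENNReal.toReal_pos_iff.mp hreal).1⟩
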